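/- Let $n$ be a non-negative integer and $\mathbb K=\mathbb R$ or $\mathbb C$. For a subgroup $G$ of $GL(n,\mathbb K)$ and $u\in\mathbb K^n$, let $G(u)=\{Au : A\in G\}\subset\mathbb K^n$ be the orbit of $u$. An orbit $\gamma$ is called regular with order $m$ if every $v\in\gamma$ has an open neighbourhood $O$ in $\mathbb K^n$ such that $\overline{\gamma}\cap O$ is an embedded $C^\infty$ submanifold of $\mathbb K^n$ of dimension $m$ over $\mathbb R$; it is called locally dense if its closure $\overline{\gamma}$ in $\mathbb K^n$ has non-empty interior. (i) If $G$ is an abelian subgroup of $GL(n,\mathbb R)$ and $u\in\mathbb R^n$, then $G(u)$ is regular with order $n$ if and only if $G(u)$ is locally dense in $\mathbb R^n$. (ii) If $G$ is an abelian subgroup of $GL(n,\mathbb C)$ and $u\in\mathbb C^n$, then $G(u)$ is regular with order $2n$ if and only if $G(u)$ is dense in $\mathbb C^n$. -/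

import Mathlib

open scoped Matrix ContDiff

/-- `S` is an embedded `C^∞` submanifold of dimension `m` (over `ℝ`) of the real normed space `E`:
around each of its points, some smooth diffeomorphism `φ` between open subsets of `E` carries `S`
onto an open piece of an `m`-dimensional real linear subspace. -/
def IsSmoothSubmanifold {E : Type*} [NormedAddCommGroup E] [NormedSpace ℝ E]
    (m : ℕ) (S : Set E) : Prop :=
  ∀ x ∈ S, ∃ (φ : OpenPartialHomeomorph E E) (F : Submodule ℝ E),
    x ∈ φ.source ∧
    ContDiffOn ℝ ∞ φ φ.source ∧
    ContDiffOn ℝ ∞ φ.symm φ.target ∧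
    Module.finrank ℝ F = m ∧
    φ '' (φ.source ∩ S) = φ.target ∩ (F : Set E)

/-- The orbit `G(u) = {A u : A ∈ G}` of a vector under a group of invertible matrices. -/
def linearOrbit {n : ℕ} {𝕜 : Type*} [RCLike 𝕜] (G : Subgroup (GL (Fin n) 𝕜))
    (u : Fin n → 𝕜) : Set (Fin n → 𝕜) :=
  {v | ∃ A ∈ G, v = (A : Matrix (Fin n) (Fin n) 𝕜) *ᵥ u}

/-- `γ` is regular with order `m`: every `v ∈ γ` has an open neighbourhood `O` such that
`closure γ ∩ O` is a manifold of dimension `m` over `ℝ`. -/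
def IsRegularOfOrder {E : Type*} [NormedAddCommGroup E] [NormedSpace ℝ E]
    (m : ℕ) (γ : Set E) : Prop :=
  ∀ v ∈ γ, ∃ O : Set E, IsOpen O ∧ v ∈ O ∧ IsSmoothSubmanifold m (closure γ ∩ O)

/-- `γ` is locally dense: its closure has non-empty interior. -/
def IsLocallyDense {E : Type*} [TopologicalSpace E] (γ : Set E) : Prop :=
  (interior (closure γ)).Nonempty

/-! A submanifold of full real dimension is open, so regularity puts the orbit inside the interior
of its closure; translating by `G`, this amounts to local density. Over `ℂ`, let `R` be the
commutative algebra generated by `G`. A locally dense orbit spans, so `a ↦ a u` is a linear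
isomorphism from `R` to `ℂⁿ` carrying `G` onto the orbit. The closure of `G` in `Rˣ` is then an open
subgroup; `Rˣ` is connected and dense in `R`, so `G` is dense in `R`. -/

section FiniteDimensionalAlgebra

variable {R : Type*} [NormedRing R] [NormedAlgebra ℂ R] [FiniteDimensional ℂ R]

lemma spectrum_finite_of_finiteDimensional (a : R) : (spectrum ℂ a).Finite := by
  have hint : IsIntegral ℂ a := Algebra.IsIntegral.isIntegral a
  have hp : minpoly ℂ a ≠ 0 := minpoly.ne_zero hint
  refine ((minpoly ℂ a).roots.toFinset.finite_toSet).subset fun z hz => ?_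
  have h := spectrum.subset_polynomial_aeval a (minpoly ℂ a) ⟨z, hz, rfl⟩
  rw [minpoly.aeval] at h
  have : Nontrivial R := by
    by_contra hR
    rw [not_nontrivial_iff_subsingleton] at hR
    simp [spectrum.of_subsingleton] at hz
  rw [spectrum.zero_eq] at h
  simpa [hp] using h

lemma finite_setOf_not_isUnit_line (a : R) :
    {z : ℂ | ¬ IsUnit (1 + z • a)}.Finite := by
  refine (((spectrum_finite_of_finiteDimensional (-a)).image (·⁻¹))).subset fun z hz => ?_
  rcases eq_or_ne z 0 with rfl | hz0
  · simp at hz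
  · refine ⟨z⁻¹, ?_, inv_inv z⟩
    rw [spectrum.mem_iff]
    intro hu
    apply hz
    have := hu.smul (Units.mk0 z hz0)
    simpa [Units.smul_def, Algebra.algebraMap_eq_smul_one, smul_add, smul_smul, hz0] using this

/-- The complex line through `1` and `a` has only finitely many non-units, and removing them leaves
it path connected. -/
lemma isPreconnected_setOf_isUnit : IsPreconnected {a : R | IsUnit a} := by
  refine isPreconnected_of_forall 1 fun a ha => ?_
  have hconn : IsPathConnected {z : ℂ | ¬ IsUnit (1 + z • (a - 1))}ᶜ :=
    (finite_setOf_not_isUnit_line (a - 1)).countable.isPathConnected_compl_of_one_lt_rank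
      (by rw [Complex.rank_real_complex]; norm_num)
  refine ⟨(fun z : ℂ => 1 + z • (a - 1)) '' {z : ℂ | ¬ IsUnit (1 + z • (a - 1))}ᶜ, ?_,
    ⟨0, by simp, by simp⟩, ⟨1, by simpa using ha, by simp⟩,
    hconn.isConnected.isPreconnected.image _ (by fun_prop)⟩
  rintro _ ⟨z, hz, rfl⟩
  simpa using hz

lemma preconnectedSpace_units : PreconnectedSpace Rˣ := by
  have : CompleteSpace R := FiniteDimensional.complete ℂ R
  refine ⟨(Units.isOpenEmbedding_val (R := R)).isInducing.isPreconnected_image.1 ?_⟩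
  rw [Set.image_univ]
  exact isPreconnected_setOf_isUnit

lemma denseRange_units_val : DenseRange (Units.val : Rˣ → R) := by
  intro a
  have hd : Dense (spectrum ℂ a)ᶜ :=
    (spectrum_finite_of_finiteDimensional a).countable.dense_compl ℂ
  have hc : Continuous fun z : ℂ => a - algebraMap ℂ R z := by
    have := (algebraMapCLM ℂ R).continuous
    fun_prop
  have h := image_closure_subset_closure_image hc ⟨0, hd 0, rfl⟩
  simp only [map_zero, sub_zero] at h
  refine closure_mono ?_ h
  rintro _ ⟨z, hz, rfl⟩
  have hu : IsUnit (algebraMap ℂ R z - a) := by simpa [spectrum.mem_iff] using hz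
  obtain ⟨v, hv⟩ := hu.neg
  exact ⟨v, by simpa using hv⟩

/-- A locally dense group of units of a finite-dimensional complex algebra is dense. -/
lemma dense_image_val_of_nonempty_interior (H : Subgroup Rˣ)
    (hH : (interior (closure (Units.val '' (H : Set Rˣ)))).Nonempty) :
    Dense (Units.val '' (H : Set Rˣ)) := by
  have : CompleteSpace R := FiniteDimensional.complete ℂ R
  have : PreconnectedSpace Rˣ := preconnectedSpace_units
  have hemb := Units.isOpenEmbedding_val (R := R)
  -- The interior of the closure is open and meets the closure, so it contains some `g` in `H`.
  obtain ⟨_, hx, g, -, rfl⟩ := mem_closure_iff.1 (interior_subset hH.some_mem) _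
    isOpen_interior hH.some_mem
  have hsub : Units.val ⁻¹' interior (closure (Units.val '' (H : Set Rˣ))) ⊆
      (H.topologicalClosure : Set Rˣ) := by
    rw [Subgroup.topologicalClosure_coe, hemb.isInducing.closure_eq_preimage_closure_image]
    exact Set.preimage_mono interior_subset
  have hopen : IsOpen (H.topologicalClosure : Set Rˣ) :=
    Subgroup.isOpen_of_mem_nhds _ (g := g) <|
      Filter.mem_of_superset ((isOpen_interior.preimage hemb.continuous).mem_nhds hx) hsub
  have huniv : (H.topologicalClosure : Set Rˣ) = Set.univ :=
    IsClopen.eq_univ ⟨H.isClosed_topologicalClosure, hopen⟩ ⟨1, H.topologicalClosure.one_mem⟩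
  exact denseRange_units_val.dense_image hemb.continuous
    (dense_iff_closure_eq.2 (by rwa [Subgroup.topologicalClosure_coe] at huniv))

lemma dense_image_linearEquiv_of_isLocallyDense {V : Type*} [NormedAddCommGroup V]
    [NormedSpace ℂ V] [FiniteDimensional ℂ V] (H : Subgroup Rˣ) (e : R ≃ₗ[ℂ] V)
    (h : IsLocallyDense (e '' (Units.val '' (H : Set Rˣ)))) :
    Dense (e '' (Units.val '' (H : Set Rˣ))) := by
  let f : R ≃ₜ V := e.toContinuousLinearEquiv.toHomeomorph
  change (interior (closure (f '' _))).Nonempty at h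
  rw [← f.image_closure, ← f.image_interior, Set.image_nonempty] at h
  exact f.surjective.denseRange.dense_image f.continuous
    (dense_image_val_of_nonempty_interior H h)

end FiniteDimensionalAlgebra

section Orbit

variable {n : ℕ} {𝕜 : Type*} [RCLike 𝕜]

lemma self_mem_linearOrbit (G : Subgroup (GL (Fin n) 𝕜)) (u : Fin n → 𝕜) :
    u ∈ linearOrbit G u :=
  ⟨1, G.one_mem, by simp⟩

lemma mulVec_mem_linearOrbit {G : Subgroup (GL (Fin n) 𝕜)} {A : GL (Fin n) 𝕜} (hA : A ∈ G)
    {u v : Fin n → 𝕜} (hv : v ∈ linearOrbit G u) :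
    (A : Matrix (Fin n) (Fin n) 𝕜) *ᵥ v ∈ linearOrbit G u := by
  obtain ⟨B, hB, rfl⟩ := hv
  exact ⟨A * B, G.mul_mem hA hB, by simp⟩

lemma mulVec_mem_closure_linearOrbit {G : Subgroup (GL (Fin n) 𝕜)} {A : GL (Fin n) 𝕜}
    (hA : A ∈ G) {u v : Fin n → 𝕜} (hv : v ∈ closure (linearOrbit G u)) :
    (A : Matrix (Fin n) (Fin n) 𝕜) *ᵥ v ∈ closure (linearOrbit G u) :=
  map_mem_closure (continuous_const.matrix_mulVec continuous_id) hv
    fun _ h => mulVec_mem_linearOrbit hA h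

lemma linearOrbit_subset_interior_closure {G : Subgroup (GL (Fin n) 𝕜)} {u : Fin n → 𝕜}
    (h : IsLocallyDense (linearOrbit G u)) :
    linearOrbit G u ⊆ interior (closure (linearOrbit G u)) := by
  obtain ⟨_, hx, A, hA, rfl⟩ := mem_closure_iff.1 (interior_subset h.some_mem) _
    isOpen_interior h.some_mem
  rintro _ ⟨B, hB, rfl⟩
  -- `A * B⁻¹` moves `B u` to the interior point `A u` and preserves the closure in both directions.
  have hC : A * B⁻¹ ∈ G := G.mul_mem hA (G.inv_mem hB)
  have hcont : Continuous fun v : Fin n → 𝕜 =>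
      ((A * B⁻¹ : GL (Fin n) 𝕜) : Matrix (Fin n) (Fin n) 𝕜) *ᵥ v :=
    continuous_const.matrix_mulVec continuous_id
  refine mem_interior.2 ⟨_ ⁻¹' interior (closure (linearOrbit G u)), fun v hv => ?_,
    isOpen_interior.preimage hcont, ?_⟩
  · have := mulVec_mem_closure_linearOrbit (G.inv_mem hC) (interior_subset hv)
    rwa [Matrix.mulVec_mulVec, ← Units.val_mul, inv_mul_cancel, Units.val_one,
      Matrix.one_mulVec] at this
  · rwa [Set.mem_preimage, Matrix.mulVec_mulVec, ← Units.val_mul, inv_mul_cancel_right]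

end Orbit

lemma IsSmoothSubmanifold.of_isOpen {E : Type*} [NormedAddCommGroup E] [NormedSpace ℝ E]
    {S : Set E} (hS : IsOpen S) : IsSmoothSubmanifold (Module.finrank ℝ E) S := by
  intro x hx
  refine ⟨OpenPartialHomeomorph.ofSet S hS, ⊤, hx, contDiffOn_id, contDiffOn_id, finrank_top ℝ E,
    by simp⟩

lemma IsSmoothSubmanifold.subset_interior {E : Type*} [NormedAddCommGroup E] [NormedSpace ℝ E]
    [FiniteDimensional ℝ E] {S : Set E} (hS : IsSmoothSubmanifold (Module.finrank ℝ E) S) :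
    S ⊆ interior S := by
  intro x hx
  obtain ⟨φ, F, hxφ, -, -, hF, himg⟩ := hS x hx
  obtain rfl : F = ⊤ := Submodule.eq_top_of_finrank_eq hF
  refine mem_interior.2 ⟨φ.source, fun y hy => ?_, φ.open_source, hxφ⟩
  have : φ y ∈ φ '' (φ.source ∩ S) := by
    rw [himg]
    exact ⟨φ.map_source hy, trivial⟩
  obtain ⟨z, ⟨hz, hzS⟩, hzy⟩ := this
  rwa [← φ.injOn hz hy hzy]

lemma isRegularOfOrder_finrank_iff {E : Type*} [NormedAddCommGroup E] [NormedSpace ℝ E]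
    [FiniteDimensional ℝ E] {γ : Set E} (hne : γ.Nonempty)
    (hγ : IsLocallyDense γ → γ ⊆ interior (closure γ)) :
    IsRegularOfOrder (Module.finrank ℝ E) γ ↔ IsLocallyDense γ := by
  constructor
  · intro h
    obtain ⟨u, hu⟩ := hne
    obtain ⟨O, -, huO, hS⟩ := h u hu
    exact ⟨u, interior_mono Set.inter_subset_left <| hS.subset_interior ⟨subset_closure hu, huO⟩⟩
  · intro h v hv
    refine ⟨interior (closure γ), isOpen_interior, hγ h hv, ?_⟩
    rw [Set.inter_eq_right.2 interior_subset]
    exact .of_isOpen isOpen_interior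

section Complex

attribute [local instance] Matrix.linftyOpNormedRing Matrix.linftyOpNormedAlgebra

lemma dense_linearOrbit_of_isLocallyDense {n : ℕ} {G : Subgroup (GL (Fin n) ℂ)}
    (hG : ∀ A ∈ G, ∀ B ∈ G, A * B = B * A) {u : Fin n → ℂ}
    (h : IsLocallyDense (linearOrbit G u)) : Dense (linearOrbit G u) := by
  let S : Set (Matrix (Fin n) (Fin n) ℂ) := Units.val '' (G : Set (GL (Fin n) ℂ))
  let R := Algebra.adjoin ℂ S
  have hcomm : IsMulCommutative R := Algebra.isMulCommutative_adjoin ℂ <| by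
    rintro _ ⟨A, hA, rfl⟩ _ ⟨B, hB, rfl⟩
    exact congrArg Units.val (hG A hA B hB)
  have hmem : ∀ A ∈ G, (A : Matrix (Fin n) (Fin n) ℂ) ∈ R := fun A hA =>
    Algebra.subset_adjoin ⟨A, hA, rfl⟩
  let ev : R →ₗ[ℂ] (Fin n → ℂ) :=
    { toFun := fun a => (a : Matrix (Fin n) (Fin n) ℂ) *ᵥ u
      map_add' := fun a b => Matrix.add_mulVec _ _ _
      map_smul' := fun c a => Matrix.smul_mulVec _ _ _ }
  have hsurj : LinearMap.range ev = ⊤ := by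
    refine Submodule.eq_top_of_nonempty_interior' _ (h.mono (interior_mono ?_))
    refine closure_minimal ?_ (Submodule.closed_of_finiteDimensional _)
    rintro _ ⟨A, hA, rfl⟩
    exact ⟨⟨A, hmem A hA⟩, rfl⟩
  -- If `a u = 0`, then `a (b u) = b (a u) = 0` for all `b` in `R`, and the vectors `b u` fill the
  -- space.
  have hinj : Function.Injective ev := by
    refine (injective_iff_map_eq_zero ev).2 fun a ha => Subtype.ext ?_
    refine Matrix.ext_of_mulVec_single fun i => ?_
    obtain ⟨b, hb⟩ := LinearMap.range_eq_top.1 hsurj (Pi.single i 1)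
    have hab : (a : Matrix (Fin n) (Fin n) ℂ) * b = b * a :=
      congrArg Subtype.val (mul_comm' a b)
    change (a : Matrix (Fin n) (Fin n) ℂ) *ᵥ u = 0 at ha
    rw [← hb]
    change (a : Matrix (Fin n) (Fin n) ℂ) *ᵥ ((b : Matrix (Fin n) (Fin n) ℂ) *ᵥ u) = _
    rw [Matrix.mulVec_mulVec, hab, ← Matrix.mulVec_mulVec, ha]
    simp
  let e : R ≃ₗ[ℂ] (Fin n → ℂ) :=
    LinearEquiv.ofBijective ev ⟨hinj, LinearMap.range_eq_top.1 hsurj⟩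
  let H : Subgroup Rˣ := G.comap (Units.map (R.val : R →* Matrix (Fin n) (Fin n) ℂ))
  have himg : e '' (Units.val '' (H : Set Rˣ)) = linearOrbit G u := by
    ext v
    constructor
    · rintro ⟨_, ⟨a, ha, rfl⟩, rfl⟩
      exact ⟨_, ha, rfl⟩
    · rintro ⟨A, hA, rfl⟩
      -- `A` is a unit of `R` itself, because `A⁻¹` also lies in `G`.
      let a : Rˣ :=
        ⟨⟨A, hmem A hA⟩, ⟨(A⁻¹ : GL (Fin n) ℂ), hmem _ (G.inv_mem hA)⟩,
          Subtype.ext A.mul_inv, Subtype.ext A.inv_mul⟩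
      refine ⟨a, ⟨a, ?_, rfl⟩, rfl⟩
      have : Units.map (R.val : R →* Matrix (Fin n) (Fin n) ℂ) a = A := Units.ext rfl
      change Units.map (R.val : R →* Matrix (Fin n) (Fin n) ℂ) a ∈ G
      rwa [this]
  rw [← himg] at h ⊢
  exact dense_image_linearEquiv_of_isLocallyDense H e h

end Complex

theorem corollaryC (n : ℕ) :
    (∀ G : Subgroup (GL (Fin n) ℝ), (∀ A ∈ G, ∀ B ∈ G, A * B = B * A) →
      ∀ u : Fin n → ℝ,
        IsRegularOfOrder n (linearOrbit G u) ↔ IsLocallyDense (linearOrbit G u)) ∧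
    (∀ G : Subgroup (GL (Fin n) ℂ), (∀ A ∈ G, ∀ B ∈ G, A * B = B * A) →
      ∀ u : Fin n → ℂ,
        IsRegularOfOrder (2 * n) (linearOrbit G u) ↔ Dense (linearOrbit G u)) := by
  refine ⟨fun G _ u => ?_, fun G hG u => ?_⟩
  · have := isRegularOfOrder_finrank_iff ⟨u, self_mem_linearOrbit G u⟩
      linearOrbit_subset_interior_closure
    rwa [Module.finrank_fin_fun] at this
  · have hdim : Module.finrank ℝ (Fin n → ℂ) = 2 * n := by
      rw [Module.finrank_pi_fintype]
      simp [Complex.finrank_real_complex, mul_comm]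
    rw [← hdim, isRegularOfOrder_finrank_iff ⟨u, self_mem_linearOrbit G u⟩
      linearOrbit_subset_interior_closure]
    refine ⟨dense_linearOrbit_of_isLocallyDense hG, fun h => ?_⟩
    rw [IsLocallyDense, h.closure_eq, interior_univ]
    exact Set.univ_nonempty
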